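/- For a group $G$ let $\Delta$ be the $G$-set of all cosets $gK$ of finite subgroups $K\le G$. A short exact sequence of $\mathbb{Z}G$-modules is called $\mathfrak{F}$-split if it splits over $\mathbb{Z}G$ after tensoring over $\mathbb{Z}$ with the permutation module $\mathbb{Z}\Delta$ (with diagonal $G$-action), and a $\mathbb{Z}G$-module is $\mathfrak{F}$-projective if it is a direct summand of $M\otimes_{\mathbb{Z}}\mathbb{Z}\Delta$ for some $\mathbb{Z}G$-module $M$. The $\mathfrak{F}$-cohomological dimension $\mathfrak{F}\mathrm{cd}\,G\in\mathbb{N}\cup\{\infty\}$ is the least length $n$ of a resolution $0\to P_n\to\dots\to P_0\to\mathbb{Z}\to 0$ of the trivial module by $\mathfrak{F}$-projective modules that is spliced together from $\mathfrak{F}$-split short exact sequences ($\infty$ if there is none of finite length). **Theorem.** Let $N\hookrightarrow G\twoheadrightarrow Q$ be a group extension. 1. Let $n\ge 0$ be an integer with $\mathfrak{F}\mathrm{cd}\,N\le n$, and suppose that for every subgroup $H$ of $G$ with $\mathfrak{F}\mathrm{cd}\,H\le n$, every extension $H\hookrightarrow L\twoheadrightarrow C$ of $H$ by a group $C$ of prime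 order has $\mathfrak{F}\mathrm{cd}\,L\le n$. Then $\mathfrak{F}\mathrm{cd}\,G\le n+\mathfrak{F}\mathrm{cd}\,Q$. 2. In particular, if the hypothesis on extensions by groups of prime order holds with $n=\mathfrak{F}\mathrm{cd}\,N$, then $\mathfrak{F}\mathrm{cd}\,G\le \mathfrak{F}\mathrm{cd}\,N+\mathfrak{F}\mathrm{cd}\,Q$. Consequently, $\mathfrak{F}\mathrm{cd}$ is subadditive, i.e. $\mathfrak{F}\mathrm{cd}\,G\le\mathfrak{F}\mathrm{cd}\,N+\mathfrak{F}\mathrm{cd}\,Q$ for all group extensions $N\hookrightarrow G\twoheadrightarrow Q$, if and only if $\mathfrak{F}\mathrm{cd}\,L\le\mathfrak{F}\mathrm{cd}\,H$ for all group extensions $H\hookrightarrow L\twoheadrightarrow C$ with $C$ of prime order. -/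

import Mathlib

universe u

namespace FCoh

open CategoryTheory

noncomputable section

/-- The standard `G`-set `Δ`: the set of all cosets `gK` of finite subgroups `K ≤ G`, with `G`
acting by left translation. -/
abbrev Cosets (G : Type u) [Group G] : Type u :=
  Σ K : {K : Subgroup G // Finite K}, G ⧸ K.1

/-! The definitions up to `fpd` are made over an arbitrary commutative ring `k`; the
`𝔉`-cohomological dimension `fcd` is the case `k = ℤ`. -/

variable (k : Type) [CommRing k]

/-- The permutation module `kΔ`. -/
abbrev permModule (G : Type u) [Group G] : Rep.{u} k G :=
  Rep.ofMulAction k G (Cosets G)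

/-- The functor `M ↦ M ⊗_k kΔ` on `kG`-modules, with the diagonal action of `G`. -/
def tensorPerm (G : Type u) [Group G] : Rep.{u} k G ⥤ Rep.{u} k G where
  obj M := Rep.of (M.ρ.tprod (permModule k G).ρ)
  map f := Rep.ofHom (Representation.IntertwiningMap.rTensor (permModule k G).ρ f.hom)
  map_id M := by ext; simp
  map_comp f g := by ext; simp

instance (G : Type u) [Group G] : (tensorPerm k G).PreservesZeroMorphisms where
  map_zero M N := by ext; simp [tensorPerm]; rfl

variable {k} {G : Type u} [Group G]

/-- A short exact sequence `A ↪ B ↠ C` of `kG`-modules is `𝔉`-split if it splits, as a sequence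
of `kG`-modules, after tensoring with `kΔ` over `k`. -/
def IsFSplit (S : ShortComplex (Rep.{u} k G)) : Prop :=
  S.ShortExact ∧ Nonempty (S.map (tensorPerm k G)).Splitting

/-- A `kG`-module is `𝔉`-projective if it is a direct summand of `M ⊗_k kΔ` for some
`kG`-module `M`. -/
def IsFProjective (P : Rep.{u} k G) : Prop :=
  ∃ M : Rep.{u} k G, Nonempty (Retract P ((tensorPerm k G).obj M))

/-- `HasFResolution n M`: there is an `𝔉`-projective resolution of `M` of length `n`, i.e. an
`𝔉`-split exact sequence `0 → Pₙ → ⋯ → P₁ → P₀ → M → 0` with all `Pᵢ` being `𝔉`-projective.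
The sequence is given by the short exact sequences `Kᵢ ↪ Pᵢ ↠ Kᵢ₋₁` of which it is spliced
together: length `0` means that `M` itself is `𝔉`-projective, and a resolution of length `n + 1`
consists of an `𝔉`-split short exact sequence `K ↪ P ↠ M` with `P` an `𝔉`-projective module,
and a resolution of `K` of length `n`. -/
inductive HasFResolution : ℕ → Rep.{u} k G → Prop
  | zero (P : Rep.{u} k G) (hP : IsFProjective P) : HasFResolution 0 P
  | succ (n : ℕ) (S : ShortComplex (Rep.{u} k G)) (hS : IsFSplit S) (hP : IsFProjective S.X₂)
      (hK : HasFResolution n S.X₁) : HasFResolution (n + 1) S.X₃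

/-- The `𝔉`-projective dimension of a `kG`-module: the least length of an `𝔉`-projective
resolution, and `⊤` if there is none of finite length. -/
def fpd (M : Rep.{u} k G) : ℕ∞ :=
  ⨅ (n : ℕ) (_ : HasFResolution n M), (n : ℕ∞)

/-- The `𝔉`-cohomological dimension of a group: the `𝔉`-projective dimension of the trivial
`ℤG`-module `ℤ` (lifted to the universe of `G`). -/
def fcd (G : Type u) [Group G] : ℕ∞ :=
  fpd (Rep.trivial ℤ G (ULift.{u} ℤ))

/-- For every subgroup `H` of `G` with `fcd H ≤ n`, every group `L` that is an extension
`H ↪ L ↠ C` of `H` by a group `C` of prime order has `fcd L ≤ n`. -/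
def PrimeExtensionsBounded (G : Type u) [Group G] (n : ℕ∞) : Prop :=
  ∀ H : Subgroup G, fcd H ≤ n →
    ∀ (L C : Type u) [Group L] [Group C], (Nat.card C).Prime → GroupExtension H L C → fcd L ≤ n

end

end FCoh

namespace FCoh

open CategoryTheory TensorProduct
open scoped MonoidAlgebra

noncomputable section

variable {k : Type} [CommRing k] {G H : Type u} [Group G] [Group H]

/-! The proof is relative homological algebra with respect to finite subgroups. Being `𝔉`-split
means splitting over every finite subgroup (`isFSplit_iff`), and being `𝔉`-projective means lifting
along maps that have sections over finite subgroups (`isFProjective_iff`). Schanuel's lemma and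
dimension shifting then work as usual.

The decisive point is that finite subgroups of prime power order suffice. For a finite `K`, the
indices of its Sylow subgroups have no common prime factor, so an integral combination of orbit sums
is a `K`-invariant of augmentation one (`hasInvariantUnits_primePowerCosets`). Hence an
`𝔉`-projective `Q`-module is a summand of its tensor product with the permutation module on cosets
of finite `p`-subgroups.

Inflated to `G`, such a tensor product is governed by the stabilisers, which are the preimages of
finite `p`-subgroups `F` of `Q`. Climbing from `N` through subgroups of index `p` bounds their
dimension by `n` (`fcd_comap_le`). So inflated `𝔉`-projectives have dimension at most `n`, and
inflating a resolution of length `m` gives the bound `n + m` (`HasFResolution.inflate`). -/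

/-- The functor `M ↦ M ⊗_k N` with the diagonal action of `G`. -/
def tensorRight (N : Rep.{u} k G) : Rep.{u} k G ⥤ Rep.{u} k G where
  obj M := Rep.of (M.ρ.tprod N.ρ)
  map f := Rep.ofHom (Representation.IntertwiningMap.rTensor N.ρ f.hom)
  map_id M := by ext; simp
  map_comp f g := by ext; simp

instance (N : Rep.{u} k G) : (tensorRight N).Additive where
  map_add {A B f g} := by
    ext x
    simp [tensorRight, Rep.add_hom]
    rfl

/-- A homomorphism of representations from an equivariant linear map. -/
def homMk {A B : Rep.{u} k G} (f : A →ₗ[k] B) (hf : ∀ g x, f (A.ρ g x) = B.ρ g (f x)) : A ⟶ B :=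
  Rep.ofHom ⟨f, fun g => LinearMap.ext (hf g)⟩

lemma hom_ext_apply {A B : Rep.{u} k G} {f g : A ⟶ B} (h : ∀ x, f.hom x = g.hom x) : f = g := by
  ext x; exact h x

lemma comp_eq_iff {A B C : Rep.{u} k G} {f : A ⟶ B} {g : B ⟶ C} {h : A ⟶ C} :
    f ≫ g = h ↔ ∀ x, g.hom (f.hom x) = h.hom x :=
  ⟨fun e x => by rw [← e]; rfl, fun e => hom_ext_apply e⟩

/-! ### Splitting over finite subgroups and relative lifting -/

/-- A homomorphism that has a section over every finite subgroup. -/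
def IsLocallySplitEpi {B C : Rep.{u} k G} (g : B ⟶ C) : Prop :=
  ∀ K : Subgroup G, Finite K → ∃ s : C →ₗ[k] B,
    (∀ h ∈ K, ∀ x, s (C.ρ h x) = B.ρ h (s x)) ∧ ∀ x, g.hom (s x) = x

/-- A sequence that splits over every finite subgroup. -/
def IsLocallySplit (S : ShortComplex (Rep.{u} k G)) : Prop :=
  ∀ K : Subgroup G, Finite K → ∃ (r : S.X₂ →ₗ[k] S.X₁) (s : S.X₃ →ₗ[k] S.X₂),
    (∀ h ∈ K, ∀ x, r (S.X₂.ρ h x) = S.X₁.ρ h (r x)) ∧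
    (∀ h ∈ K, ∀ x, s (S.X₃.ρ h x) = S.X₂.ρ h (s x)) ∧
    (∀ x, r (S.f.hom x) = x) ∧ (∀ x, S.g.hom (s x) = x) ∧
    ∀ x, S.f.hom (r x) + s (S.g.hom x) = x

lemma IsLocallySplit.epi {S : ShortComplex (Rep.{u} k G)} (hS : IsLocallySplit S) :
    IsLocallySplitEpi S.g := fun K hK => by
  obtain ⟨r, s, -, h, -, h', -⟩ := hS K hK
  exact ⟨s, h, h'⟩

/-- The lifting property along locally split epimorphisms. -/
def HasLifting (P : Rep.{u} k G) : Prop :=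
  ∀ ⦃B C : Rep.{u} k G⦄ (g : B ⟶ C), IsLocallySplitEpi g →
    ∀ φ : P ⟶ C, ∃ ψ : P ⟶ B, ψ ≫ g = φ

lemma HasLifting.of_retract {P P' : Rep.{u} k G} (h : HasLifting P) (r : Retract P' P) :
    HasLifting P' := fun B C g hg φ => by
  obtain ⟨ψ, hψ⟩ := h g hg (r.r ≫ φ)
  exact ⟨r.i ≫ ψ, by simp [hψ]⟩

lemma tensorRight_ext {A N : Rep.{u} k G} {B : Type u} [AddCommGroup B] [Module k B]
    {f g : (tensorRight N).obj A →ₗ[k] B}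
    (h : ∀ (a : A) (n : N), f (a ⊗ₜ[k] n) = g (a ⊗ₜ[k] n)) : f = g :=
  TensorProduct.ext' h

lemma tensorRight_ρ_tmul {A N : Rep.{u} k G} (g : G) (a : A) (n : N) :
    ((tensorRight N).obj A).ρ g (a ⊗ₜ[k] n) = A.ρ g a ⊗ₜ[k] N.ρ g n :=
  TensorProduct.map_tmul _ _ _ _

lemma rTensor_equivariant {A B : Rep.{u} k G} (N : Rep.{u} k G) {s : A →ₗ[k] B} {h : G}
    (hs : ∀ x, s (A.ρ h x) = B.ρ h (s x)) (x : (tensorRight N).obj A) :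
    s.rTensor N (((tensorRight N).obj A).ρ h x) = ((tensorRight N).obj B).ρ h (s.rTensor N x) :=
  LinearMap.congr_fun (f := s.rTensor N ∘ₗ ((tensorRight N).obj A).ρ h)
    (g := ((tensorRight N).obj B).ρ h ∘ₗ s.rTensor N)
    (tensorRight_ext fun a n => by
      refine (congrArg (s.rTensor N) (tensorRight_ρ_tmul h a n)).trans ?_
      refine (LinearMap.rTensor_tmul _ _ _ _).trans ?_
      rw [hs]
      exact (tensorRight_ρ_tmul h (s a) n).symm) x

lemma rTensor_section {A B : Rep.{u} k G} (N : Rep.{u} k G) {s : A →ₗ[k] B} {g : B →ₗ[k] A}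
    (hs : ∀ x, g (s x) = x) (x : (tensorRight N).obj A) :
    g.rTensor N (s.rTensor N x) = x := by
  have h : g ∘ₗ s = LinearMap.id := LinearMap.ext hs
  have h' := congrArg (fun φ => φ.rTensor N x) h
  simp only [LinearMap.rTensor_comp, LinearMap.rTensor_id] at h'
  exact h'

lemma IsLocallySplit.map_tensorRight {S : ShortComplex (Rep.{u} k G)} (hS : IsLocallySplit S)
    (N : Rep.{u} k G) : IsLocallySplit (S.map (tensorRight N)) := fun K hK => by
  obtain ⟨r, s, h1, h2, h3, h4, h5⟩ := hS K hK
  refine ⟨r.rTensor N, s.rTensor N, fun h hh => rTensor_equivariant N (h1 h hh),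
    fun h hh => rTensor_equivariant N (h2 h hh), rTensor_section N h3, rTensor_section N h4, ?_⟩
  have h : S.f.hom.toLinearMap ∘ₗ r + s ∘ₗ S.g.hom.toLinearMap = LinearMap.id :=
    LinearMap.ext h5
  intro x
  have h' := congrArg (fun φ => φ.rTensor N x) h
  simp only [LinearMap.rTensor_add, LinearMap.rTensor_comp, LinearMap.rTensor_id] at h'
  exact h'

lemma finite_map_subgroup (φ : H →* G) (K : Subgroup H) [Finite K] : Finite (K.map φ) :=
  Finite.of_surjective _ (φ.subgroupMap_surjective K)

lemma IsLocallySplitEpi.map_res {B C : Rep.{u} k G} {g : B ⟶ C}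
    (hg : IsLocallySplitEpi g) (φ : H →* G) :
    IsLocallySplitEpi ((Rep.resFunctor φ).map g) := fun K hK => by
  obtain ⟨s, h1, h2⟩ := hg (K.map φ) (finite_map_subgroup φ K)
  exact ⟨s, fun h hh => h1 (φ h) (Subgroup.mem_map_of_mem φ hh), h2⟩

/-- Images of finite subgroups are finite, so `φ` need not be injective; this is what allows
inflation along `G ↠ Q`. -/
lemma IsLocallySplit.map_res {S : ShortComplex (Rep.{u} k G)} (hS : IsLocallySplit S)
    (φ : H →* G) : IsLocallySplit (S.map (Rep.resFunctor φ)) := fun K hK => by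
  obtain ⟨r, s, h1, h2, h3⟩ := hS (K.map φ) (finite_map_subgroup φ K)
  exact ⟨r, s, fun h hh => h1 (φ h) (Subgroup.mem_map_of_mem φ hh),
    fun h hh => h2 (φ h) (Subgroup.mem_map_of_mem φ hh), h3⟩

/-- Over a finite group, every module has the lifting property. -/
lemma hasLifting_of_finite [Finite G] (P : Rep.{u} k G) : HasLifting P := fun B C g hg φ => by
  obtain ⟨s, h1, h2⟩ := hg ⊤ inferInstance
  refine ⟨homMk (s ∘ₗ φ.hom.toLinearMap) fun x p => ?_, comp_eq_iff.2 fun p => h2 (φ.hom p)⟩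
  exact (congrArg s (Rep.hom_comm_apply φ x p)).trans (h1 x (Subgroup.mem_top x) _)

/-! ### Tensor products with permutation modules -/

section Perm

variable (X : Type u) [MulAction G X]

/-- The inclusion `V → V ⊗ kX` of the summand of `x`. -/
def permIncl (V : Rep.{u} k G) (x : X) :
    V →ₗ[k] (tensorRight (Rep.ofMulAction k G X)).obj V :=
  (TensorProduct.mk k V k[X]).flip (MonoidAlgebra.single x 1)

variable {X}

/-- The linear map on `V ⊗ kX` with given components. -/
def permDesc {V : Rep.{u} k G} {B : Type u} [AddCommGroup B] [Module k B]
    (Ψ : X → (V →ₗ[k] B)) : (tensorRight (Rep.ofMulAction k G X)).obj V →ₗ[k] B :=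
  TensorProduct.lift (R := k) (M := V) (N := k[X]) (P₂ := B) (Finsupp.lift (V →ₗ[k] B) k X Ψ ∘ₗ
    (MonoidAlgebra.coeffLinearEquiv k).toLinearMap).flip

@[simp] lemma permDesc_permIncl {V : Rep.{u} k G} {B : Type u} [AddCommGroup B] [Module k B]
    (Ψ : X → (V →ₗ[k] B)) (x : X) (v : V) : permDesc Ψ (permIncl X V x v) = Ψ x v := by
  refine (TensorProduct.lift.tmul (R := k) (M := V) (N := k[X]) (P₂ := B) _ _).trans ?_
  simp

lemma perm_hom_ext {V : Rep.{u} k G} {B : Type u} [AddCommGroup B] [Module k B]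
    {f g : (tensorRight (Rep.ofMulAction k G X)).obj V →ₗ[k] B}
    (h : ∀ x v, f (permIncl X V x v) = g (permIncl X V x v)) : f = g := by
  refine TensorProduct.ext (M := V) (N := k[X]) (LinearMap.ext fun v =>
    MonoidAlgebra.lhom_ext' fun x => LinearMap.ext_ring ?_)
  exact h x v

lemma permIncl_smul (V : Rep.{u} k G) (a : G) (x : X) (v : V) :
    ((tensorRight (Rep.ofMulAction k G X)).obj V).ρ a (permIncl X V x v) =
      permIncl X V (a • x) (V.ρ a v) := by
  refine (TensorProduct.map_tmul (M := V) (N := k[X]) _ _ _ _).trans ?_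
  rw [Representation.ofMulAction_single]
  rfl

/-- A homomorphism out of `V ⊗ kX` from an equivariant family of linear maps. -/
def permHom {V B : Rep.{u} k G} (Ψ : X → (V →ₗ[k] B))
    (hΨ : ∀ (a : G) (x : X) (v : V), Ψ (a • x) (V.ρ a v) = B.ρ a (Ψ x v)) :
    (tensorRight (Rep.ofMulAction k G X)).obj V ⟶ B :=
  homMk (permDesc Ψ) fun a => LinearMap.congr_fun
    (f := permDesc Ψ ∘ₗ ((tensorRight (Rep.ofMulAction k G X)).obj V).ρ a)
    (g := B.ρ a ∘ₗ permDesc Ψ) <| perm_hom_ext fun x v => by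
      simp [permIncl_smul, hΨ]

@[simp] lemma permHom_permIncl {V B : Rep.{u} k G} (Ψ : X → (V →ₗ[k] B))
    (hΨ : ∀ (a : G) (x : X) (v : V), Ψ (a • x) (V.ρ a v) = B.ρ a (Ψ x v)) (x : X) (v : V) :
    (permHom Ψ hΨ).hom (permIncl X V x v) = Ψ x v :=
  permDesc_permIncl Ψ x v

lemma perm_ext {V B : Rep.{u} k G} {f g : (tensorRight (Rep.ofMulAction k G X)).obj V ⟶ B}
    (h : ∀ x v, f.hom (permIncl X V x v) = g.hom (permIncl X V x v)) : f = g :=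
  hom_ext_apply fun y => LinearMap.congr_fun
    (perm_hom_ext (f := f.hom.toLinearMap) (g := g.hom.toLinearMap) h) y

/-- If a module has the lifting property over all stabilisers of a `G`-set `X`, then its tensor
product with the permutation module of `X` has the lifting property. -/
theorem hasLifting_tensor_ofMulAction (V : Rep.{u} k G)
    (hV : ∀ x : X, HasLifting (Rep.res (MulAction.stabilizer G x).subtype V)) :
    HasLifting ((tensorRight (Rep.ofMulAction k G X)).obj V) := fun B C g hg φ => by
  have key : ∀ x : X, ∃ ψ : V →ₗ[k] B,
      (∀ h ∈ MulAction.stabilizer G x, ∀ v, ψ (V.ρ h v) = B.ρ h (ψ v)) ∧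
      ∀ v, g.hom (ψ v) = φ.hom (permIncl X V x v) := fun x => by
    let S := MulAction.stabilizer G x
    let φx : Rep.res S.subtype V ⟶ Rep.res S.subtype C :=
      homMk (A := Rep.res S.subtype V) (B := Rep.res S.subtype C)
        (φ.hom.toLinearMap ∘ₗ permIncl X V x) fun h v => by
          have h1 := Rep.hom_comm_apply φ (h : G) (permIncl X V x v)
          have h2 : (h : G) • x = x := h.2
          rw [permIncl_smul, h2] at h1
          exact h1
    obtain ⟨ψ, hψ⟩ := hV x ((Rep.resFunctor S.subtype).map g) (hg.map_res S.subtype) φx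
    rw [comp_eq_iff] at hψ
    exact ⟨ψ.hom.toLinearMap, fun h hh v => Rep.hom_comm_apply ψ ⟨h, hh⟩ v, hψ⟩
  choose ψ hψ hgψ using key
  -- Only the lifts at the orbit representatives `o x` are kept; `t x` carries `o x` to `x` and
  -- transports the lift there.
  let o : X → X := fun x => Quotient.out (s := MulAction.orbitRel G X) (Quotient.mk _ x)
  have ho : ∀ x, ∃ t : G, t • o x = x := fun x =>
    (MulAction.orbitRel G X).symm (Quotient.mk_out (s := MulAction.orbitRel G X) x)
  choose t ht using ho
  have ho' : ∀ (a : G) x, o (a • x) = o x := fun a x =>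
    congrArg (Quotient.out (s := MulAction.orbitRel G X))
      (Quotient.sound (s := MulAction.orbitRel G X) ⟨a, rfl⟩)
  let Ψ : X → (V →ₗ[k] B) := fun x => B.ρ (t x) ∘ₗ ψ (o x) ∘ₗ V.ρ (t x)⁻¹
  have hΨ : ∀ (a : G) (x : X) (v : V), Ψ (a • x) (V.ρ a v) = B.ρ a (Ψ x v) := fun a x v => by
    -- The two transports to `a • x` differ by this element of the stabiliser of `o x`, for which `ψ
    -- (o x)` is equivariant.
    have hmem : (t (a • x))⁻¹ * a * t x ∈ MulAction.stabilizer G (o x) := by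
      rw [MulAction.mem_stabilizer_iff, mul_smul, mul_smul, ht, inv_smul_eq_iff, ← ho' a x, ht]
    have h1 := hψ (o x) _ hmem (V.ρ (t x)⁻¹ v)
    have h2 : V.ρ (t (a • x))⁻¹ (V.ρ a v) = V.ρ ((t (a • x))⁻¹ * a * t x) (V.ρ (t x)⁻¹ v) := by
      simp only [← Module.End.mul_apply, ← map_mul]
      simp [mul_assoc]
    simp only [Ψ, LinearMap.comp_apply, ho', h2, h1]
    simp only [← Module.End.mul_apply, ← map_mul]
    simp [mul_assoc]
  refine ⟨permHom Ψ hΨ, ?_⟩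
  rw [← Category.id_comp φ, ← Category.id_comp (permHom Ψ hΨ ≫ g)]
  refine perm_ext fun x v => ?_
  have h1 : g.hom (Ψ x v) = C.ρ (t x) (φ.hom (permIncl X V (o x) (V.ρ (t x)⁻¹ v))) := by
    rw [← hgψ]
    exact Rep.hom_comm_apply g _ _
  rw [← Rep.hom_comm_apply φ, permIncl_smul, ht] at h1
  refine (congrArg g.hom (permHom_permIncl Ψ hΨ x v)).trans (h1.trans ?_)
  simp [← Module.End.mul_apply, ← map_mul]

/-- The tensor product with the permutation module of a `G`-set with finite stabilisers has the
lifting property. -/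
theorem hasLifting_tensor_of_finite (V : Rep.{u} k G)
    (hX : ∀ x : X, Finite (MulAction.stabilizer G x)) :
    HasLifting ((tensorRight (Rep.ofMulAction k G X)).obj V) :=
  hasLifting_tensor_ofMulAction V fun x => have := hX x; hasLifting_of_finite _

end Perm

/-! ### The augmentation of a permutation module and its kernel -/

section Aug

variable {X : Type u} [MulAction G X]

/-- The augmentation `kX → k` of a permutation module. -/
def aug (k : Type) [CommRing k] (X : Type u) : k[X] →ₗ[k] k :=
  Finsupp.lift k k X (fun _ => 1) ∘ₗ (MonoidAlgebra.coeffLinearEquiv k).toLinearMap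

@[simp] lemma aug_single (x : X) (r : k) : aug k X (MonoidAlgebra.single x r) = r := by
  simp [aug]

lemma aug_ofMulAction (a : G) (y : k[X]) :
    aug k X (Representation.ofMulAction k G X a y) = aug k X y :=
  LinearMap.congr_fun (f := aug k X ∘ₗ Representation.ofMulAction k G X a) (g := aug k X)
    (MonoidAlgebra.lhom_ext' fun x => LinearMap.ext_ring (by simp)) y

/-- The homomorphism `V ⊗ kX → V` given by the augmentation. -/
def tensorAug (X : Type u) [MulAction G X] (V : Rep.{u} k G) :
    (tensorRight (Rep.ofMulAction k G X)).obj V ⟶ V :=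
  permHom (fun _ => LinearMap.id) fun _ _ _ => rfl

lemma tensorAug_permIncl (V : Rep.{u} k G) (x : X) (v : V) :
    (tensorAug X V).hom (permIncl X V x v) = v :=
  permHom_permIncl _ _ x v

lemma tensorAug_tmul (V : Rep.{u} k G) (v : V) (y : k[X]) :
    (tensorAug X V).hom (v ⊗ₜ[k] y : V ⊗[k] k[X]) = aug k X y • v :=
  LinearMap.congr_fun
    (f := (tensorAug X V).hom.toLinearMap ∘ₗ TensorProduct.mk k V k[X] v)
    (g := (aug k X).smulRight v)
    (MonoidAlgebra.lhom_ext' fun x => LinearMap.ext_ring (by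
      simp only [LinearMap.comp_apply, LinearMap.smulRight_apply, MonoidAlgebra.lsingle_apply,
        aug_single, one_smul]
      exact tensorAug_permIncl V x v)) y

/-- Every finite subgroup fixes an element of augmentation one in `kX`. -/
def HasInvariantUnits (k : Type) [CommRing k] (G : Type u) [Group G] (X : Type u)
    [MulAction G X] : Prop :=
  ∀ K : Subgroup G, Finite K →
    ∃ e : k[X], (∀ h ∈ K, Representation.ofMulAction k G X h e = e) ∧ aug k X e = 1

/-- The section over `K` is `v ↦ v ⊗ e`, equivariant because `K` fixes `e`. -/
lemma isLocallySplitEpi_tensorAug (hX : HasInvariantUnits k G X) (V : Rep.{u} k G) :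
    IsLocallySplitEpi (tensorAug X V) := fun K hK => by
  obtain ⟨e, he, he'⟩ := hX K hK
  refine ⟨(TensorProduct.mk k V k[X]).flip e, fun h hh v => ?_, fun v => ?_⟩
  · refine Eq.trans ?_ (tensorRight_ρ_tmul (N := Rep.ofMulAction k G X) h v e).symm
    rw [he h hh]
    rfl
  · refine (tensorAug_tmul V v e).trans ?_
    rw [he', one_smul]

/-- A module with the lifting property is a direct summand of its tensor product with `kX`. -/
lemma HasLifting.exists_retract (hX : HasInvariantUnits k G X) {P : Rep.{u} k G}
    (hP : HasLifting P) : Nonempty (Retract P ((tensorRight (Rep.ofMulAction k G X)).obj P)) := by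
  obtain ⟨ψ, hψ⟩ := hP (tensorAug X P) (isLocallySplitEpi_tensorAug hX P) (𝟙 P)
  exact ⟨⟨ψ, _, hψ⟩⟩

/-- The kernel of the augmentation `kX → k`. -/
def augKernel (k : Type) [CommRing k] (G X : Type u) [Group G] [MulAction G X] : Rep.{u} k G :=
  (Rep.ofMulAction k G X).subrepresentation (LinearMap.ker (aug k X)) fun a y hy => by
    rw [Submodule.mem_comap, LinearMap.mem_ker]
    exact (aug_ofMulAction a y).trans hy

/-- The inclusion `V ⊗ ker(aug) → V ⊗ kX`. -/
def tensorKernelIncl (X : Type u) [MulAction G X] (V : Rep.{u} k G) :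
    (tensorRight (augKernel k G X)).obj V ⟶ (tensorRight (Rep.ofMulAction k G X)).obj V :=
  Rep.ofHom (Representation.IntertwiningMap.lTensor V.ρ
    (Rep.subtype (Rep.ofMulAction k G X) (LinearMap.ker (aug k X)) _).hom)

lemma tensorKernelIncl_comp (V : Rep.{u} k G) :
    tensorKernelIncl X V ≫ tensorAug X V = 0 := by
  refine comp_eq_iff.2 fun x => ?_
  refine LinearMap.congr_fun
    (f := (tensorAug X V).hom.toLinearMap ∘ₗ (tensorKernelIncl X V).hom.toLinearMap) (g := 0)
    (TensorProduct.ext' (M := V) (N := LinearMap.ker (aug k X)) fun v y => ?_) x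
  refine (tensorAug_tmul V v (y : k[X])).trans ?_
  rw [LinearMap.mem_ker.1 y.2, zero_smul]
  rfl

/-- The sequence `V ⊗ ker(aug) → V ⊗ kX → V`. -/
def augSequence (X : Type u) [MulAction G X] (V : Rep.{u} k G) : ShortComplex (Rep.{u} k G) :=
  ShortComplex.mk (tensorKernelIncl X V) (tensorAug X V) (tensorKernelIncl_comp V)

lemma isLocallySplit_augSequence (hX : HasInvariantUnits k G X) (V : Rep.{u} k G) :
    IsLocallySplit (augSequence X V) := fun K hK => by
  obtain ⟨e, he, he'⟩ := hX K hK
  -- The projection `y ↦ y - aug(y) e` onto the augmentation kernel along `e`.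
  let ρ : k[X] →ₗ[k] LinearMap.ker (aug k X) :=
    (LinearMap.id - (aug k X).smulRight e).codRestrict _ fun y => by simp [he']
  have hρ : ∀ y, ((ρ y : LinearMap.ker (aug k X)) : k[X]) = y - aug k X y • e := fun y => rfl
  refine ⟨ρ.lTensor V, (TensorProduct.mk k V k[X]).flip e, fun h hh => ?_, fun h hh v => ?_,
    ?_, fun v => ?_, ?_⟩
  · refine LinearMap.congr_fun (f := ρ.lTensor V ∘ₗ (augSequence X V).X₂.ρ h)
      (g := (augSequence X V).X₁.ρ h ∘ₗ ρ.lTensor V) <|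
      TensorProduct.ext' (M := V) (N := k[X]) fun v y => ?_
    refine congrArg (fun z => V.ρ h v ⊗ₜ[k] z) (Subtype.ext ?_)
    have : Representation.ofMulAction k G X h (ρ y) =
      ρ (Representation.ofMulAction k G X h y) := by
        rw [hρ, hρ, map_sub, map_smul, he h hh, aug_ofMulAction]
    exact this.symm
  · refine Eq.trans ?_ (tensorRight_ρ_tmul (N := Rep.ofMulAction k G X) h v e).symm
    rw [he h hh]
    rfl
  · refine LinearMap.congr_fun
      (f := ρ.lTensor V ∘ₗ (tensorKernelIncl X V).hom.toLinearMap) (g := LinearMap.id) <|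
      TensorProduct.ext' (M := V) (N := LinearMap.ker (aug k X)) fun v y => ?_
    refine congrArg (fun z => v ⊗ₜ[k] z) (Subtype.ext ?_)
    refine (hρ y).trans ?_
    rw [LinearMap.mem_ker.1 y.2, zero_smul, sub_zero]
  · refine (tensorAug_tmul V v e).trans ?_
    rw [he']
    exact one_smul k (v : V)
  · let g : V ⊗[k] k[X] →ₗ[k] V := (tensorAug X V).hom.toLinearMap
    refine LinearMap.congr_fun
      (f := ((LinearMap.ker (aug k X)).subtype.lTensor V ∘ₗ ρ.lTensor V +
        (TensorProduct.mk k V k[X]).flip e ∘ₗ g))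
      (g := LinearMap.id) <|
      TensorProduct.ext' (M := V) (N := k[X]) fun v y => ?_
    have h1 : (LinearMap.ker (aug k X)).subtype.lTensor V (ρ.lTensor V (v ⊗ₜ[k] y)) =
      v ⊗ₜ[k] (y - aug k X y • e) := rfl
    have h2 := congrArg ((TensorProduct.mk k V k[X]).flip e) (tensorAug_tmul V v y)
    refine (congrArg₂ (· + ·) h1 h2).trans ?_
    simp [TensorProduct.tmul_sub, TensorProduct.smul_tmul']

end Aug

/-! ### Stabilisers and fixed points of coset spaces -/

section Cosets

/-- The stabiliser of a coset. -/
lemma stabilizer_sigma_coset (p : Subgroup G → Prop) (x : Σ K : {K : Subgroup G // p K}, G ⧸ K.1) :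
    ∃ (K : Subgroup G) (g : G), p K ∧
      MulAction.stabilizer G x = K.map (MulAut.conj g).toMonoidHom := by
  obtain ⟨⟨K, hK⟩, q⟩ := x
  induction q using QuotientGroup.induction_on with | H g => ?_
  refine ⟨K, g, hK, ?_⟩
  ext a
  rw [MulAction.mem_stabilizer_iff, Subgroup.mem_map_equiv]
  have : a • (⟨⟨K, hK⟩, (g : G ⧸ K)⟩ : Σ K : {K : Subgroup G // p K}, G ⧸ K.1) =
    ⟨⟨K, hK⟩, ((a * g : G) : G ⧸ K)⟩ := rfl
  rw [this, Sigma.mk.injEq]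
  simp only [heq_eq_eq, true_and]
  rw [eq_comm, QuotientGroup.eq]
  simp [mul_assoc]

lemma finite_stabilizer_cosets (x : Cosets G) : Finite (MulAction.stabilizer G x) := by
  obtain ⟨K, g, hK, h⟩ := stabilizer_sigma_coset (fun K : Subgroup G => Finite K) x
  rw [h]
  exact finite_map_subgroup _ K

lemma smul_coset_one (p : Subgroup G → Prop) {K : Subgroup G} (hK : p K) {h : G} (hh : h ∈ K) :
    h • (⟨⟨K, hK⟩, ((1 : G) : G ⧸ K)⟩ : Σ K : {K : Subgroup G // p K}, G ⧸ K.1) =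
      ⟨⟨K, hK⟩, ((1 : G) : G ⧸ K)⟩ := by
  have : h • (⟨⟨K, hK⟩, ((1 : G) : G ⧸ K)⟩ : Σ K : {K : Subgroup G // p K}, G ⧸ K.1) =
    ⟨⟨K, hK⟩, ((h * 1 : G) : G ⧸ K)⟩ := rfl
  rw [this, Sigma.mk.injEq]
  simp only [heq_eq_eq, true_and]
  rw [eq_comm, QuotientGroup.eq]
  simpa using hh

lemma hasInvariantUnits_cosets : HasInvariantUnits k G (Cosets G) := fun K hK =>
  ⟨MonoidAlgebra.single ⟨⟨K, hK⟩, ((1 : G) : G ⧸ K)⟩ 1, fun h hh => by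
    rw [Representation.ofMulAction_single, smul_coset_one (fun K : Subgroup G => Finite K) hK hh],
    aug_single _ _⟩

end Cosets

/-! ### `𝔉`-projective and `𝔉`-split in terms of finite subgroups -/

/-- `𝔉`-projectivity is the lifting property along locally split epimorphisms. -/
theorem isFProjective_iff (P : Rep.{u} k G) : IsFProjective P ↔ HasLifting P := by
  refine ⟨fun ⟨M, ⟨r⟩⟩ => ?_, fun h => ⟨P, h.exists_retract hasInvariantUnits_cosets⟩⟩
  exact (hasLifting_tensor_of_finite M finite_stabilizer_cosets).of_retract r

lemma IsLocallySplit.shortExact {S : ShortComplex (Rep.{u} k G)} (hS : IsLocallySplit S) :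
    S.ShortExact := by
  obtain ⟨r, s, -, -, h1, h2, h3⟩ := hS ⊥ inferInstance
  have hm : Mono S.f := (Rep.mono_iff_injective _).2 (Function.LeftInverse.injective h1)
  have he : Epi S.g := (Rep.epi_iff_surjective _).2 (Function.RightInverse.surjective h2)
  refine ⟨?_⟩
  rw [← ShortComplex.exact_map_iff_of_faithful S (forget₂ (Rep.{u} k G) (ModuleCat.{u} k)),
    ShortComplex.moduleCat_exact_iff]
  intro x hx
  refine ⟨r x, ?_⟩
  have h4 := h3 x
  have hx' : S.g.hom x = 0 := hx
  rw [hx', map_zero, add_zero] at h4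
  exact h4

/-- A sequence is `𝔉`-split if and only if it splits over every finite subgroup. -/
theorem isFSplit_iff (S : ShortComplex (Rep.{u} k G)) : IsFSplit S ↔ IsLocallySplit S := by
  classical
  constructor
  · rintro ⟨-, ⟨σ⟩⟩ K hK
    -- Since `K` fixes `δ`, the summand at `δ` makes `V` a `K`-summand of `V ⊗ kΔ`, naturally in
    -- `V`, with projection `c`. Compressing `σ` to these summands splits `S` over `K`.
    let δ : Cosets G := ⟨⟨K, hK⟩, ((1 : G) : G ⧸ K)⟩
    have hδ : ∀ h ∈ K, h • δ = δ := fun h hh =>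
      smul_coset_one (fun K : Subgroup G => Finite K) hK hh
    let c (V : Rep.{u} k G) : (tensorRight (permModule k G)).obj V →ₗ[k] V :=
      permDesc fun x => if x = δ then LinearMap.id else 0
    have hc1 : ∀ (V : Rep.{u} k G) (v : V), c V (permIncl _ V δ v) = v := fun V v => by simp [c]
    have hc2 : ∀ {V W : Rep.{u} k G} (f : V ⟶ W) (y : (tensorRight (permModule k G)).obj V),
        c W (((tensorRight (permModule k G)).map f).hom y) = f.hom (c V y) := fun {V W} f =>
      LinearMap.congr_fun
        (f := c W ∘ₗ ((tensorRight (permModule k G)).map f).hom.toLinearMap)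
        (g := f.hom.toLinearMap ∘ₗ c V) <| perm_hom_ext fun x v => by
          have h1 : ((tensorRight (permModule k G)).map f).hom (permIncl _ V x v) =
            permIncl _ W x (f.hom v) := rfl
          refine (congrArg (c W) h1).trans ?_
          simp only [c, permDesc_permIncl, LinearMap.comp_apply]
          split_ifs <;> simp
    have hc3 : ∀ (V : Rep.{u} k G), ∀ h ∈ K, ∀ y,
        c V (((tensorRight (permModule k G)).obj V).ρ h y) = V.ρ h (c V y) := fun V h hh =>
      LinearMap.congr_fun (f := c V ∘ₗ ((tensorRight (permModule k G)).obj V).ρ h)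
        (g := V.ρ h ∘ₗ c V) <| perm_hom_ext fun x v => by
          have h1 : h • x = δ ↔ x = δ := by
            rw [← hδ h hh, smul_left_cancel_iff, hδ h hh]
          simp only [c, permDesc_permIncl, LinearMap.comp_apply, permIncl_smul, h1]
          split_ifs <;> simp
    have hi : ∀ (V : Rep.{u} k G), ∀ h ∈ K, ∀ v, permIncl _ V δ (V.ρ h v) =
        ((tensorRight (permModule k G)).obj V).ρ h (permIncl _ V δ v) := fun V h hh v => by
      rw [permIncl_smul, hδ h hh]
    have hf : ∀ {V W : Rep.{u} k G} (f : V ⟶ W) v, permIncl _ W δ (f.hom v) =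
      ((tensorRight (permModule k G)).map f).hom (permIncl _ V δ v) := fun f v => rfl
    let r : (tensorRight (permModule k G)).obj S.X₂ ⟶ (tensorRight (permModule k G)).obj S.X₁ := σ.r
    let s : (tensorRight (permModule k G)).obj S.X₃ ⟶ (tensorRight (permModule k G)).obj S.X₂ := σ.s
    have h1 := comp_eq_iff.1 (show (tensorRight (permModule k G)).map S.f ≫ r = 𝟙 _ from σ.f_r)
    have h2 := comp_eq_iff.1 (show s ≫ (tensorRight (permModule k G)).map S.g = 𝟙 _ from σ.s_g)
    have h3 : ∀ y, ((tensorRight (permModule k G)).map S.f).hom (r.hom y) +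
        s.hom (((tensorRight (permModule k G)).map S.g).hom y) = y := fun y =>
      congrArg (fun φ => φ.hom y) σ.id
    refine ⟨c S.X₁ ∘ₗ r.hom.toLinearMap ∘ₗ permIncl _ S.X₂ δ,
      c S.X₂ ∘ₗ s.hom.toLinearMap ∘ₗ permIncl _ S.X₃ δ, fun h hh x => ?_, fun h hh x => ?_,
      fun x => ?_, fun x => ?_, fun x => ?_⟩
    · have h4 := Rep.hom_comm_apply r h (permIncl _ S.X₂ δ x)
      rw [← hi _ h hh] at h4
      exact (congrArg _ h4).trans (hc3 _ h hh _)
    · have h4 := Rep.hom_comm_apply s h (permIncl _ S.X₃ δ x)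
      rw [← hi _ h hh] at h4
      exact (congrArg _ h4).trans (hc3 _ h hh _)
    · exact (congrArg (c S.X₁) (h1 (permIncl _ S.X₁ δ x))).trans (hc1 _ x)
    · refine (hc2 S.g _).symm.trans ?_
      exact (congrArg (c S.X₃) (h2 (permIncl _ S.X₃ δ x))).trans (hc1 _ x)
    · refine Eq.trans (congrArg₂ (· + ·) (hc2 S.f _).symm rfl) ?_
      refine ((c S.X₂).map_add _ _).symm.trans ?_
      exact (congrArg (c S.X₂) (h3 (permIncl _ S.X₂ δ x))).trans (hc1 _ x)
  · intro hS
    refine ⟨hS.shortExact, ?_⟩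
    -- The tensored sequence is still locally split and its last term has the lifting property, so
    -- the identity lifts to a section.
    have hT := hS.map_tensorRight (permModule k G)
    obtain ⟨s, hs⟩ := hasLifting_tensor_of_finite S.X₃ finite_stabilizer_cosets _ hT.epi (𝟙 _)
    exact ⟨ShortComplex.Splitting.ofExactOfSection _ hT.shortExact.exact s hs hT.shortExact.mono_f⟩

/-! ### Schanuel's lemma and dimension shifting -/

lemma hasFResolution_zero {P : Rep.{u} k G} (hP : HasLifting P) : HasFResolution 0 P :=
  .zero P ((isFProjective_iff P).2 hP)

lemma HasFResolution.hasLifting {P : Rep.{u} k G} (h : HasFResolution 0 P) : HasLifting P := by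
  cases h with
  | zero _ hP => exact (isFProjective_iff P).1 hP

lemma IsLocallySplit.hasFResolution {S : ShortComplex (Rep.{u} k G)} (hS : IsLocallySplit S)
    (hP : HasLifting S.X₂) {n : ℕ} (hK : HasFResolution n S.X₁) : HasFResolution (n + 1) S.X₃ :=
  .succ n S ((isFSplit_iff S).2 hS) ((isFProjective_iff _).2 hP) hK

lemma HasFResolution.exists_of_succ {n : ℕ} {M : Rep.{u} k G} (h : HasFResolution (n + 1) M) :
    ∃ S : ShortComplex (Rep.{u} k G), S.X₃ = M ∧ IsLocallySplit S ∧ HasLifting S.X₂ ∧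
      HasFResolution n S.X₁ := by
  cases h with
  | succ _ S hS hP hK =>
    exact ⟨S, rfl, (isFSplit_iff S).1 hS, (isFProjective_iff _).1 hP, hK⟩

/-- The coset permutation module sequence `V ⊗ ker(aug) → V ⊗ kΔ → V`. -/
abbrev cosetSequence (V : Rep.{u} k G) : ShortComplex (Rep.{u} k G) :=
  augSequence (Cosets G) V

lemma isLocallySplit_cosetSequence (V : Rep.{u} k G) : IsLocallySplit (cosetSequence V) :=
  isLocallySplit_augSequence hasInvariantUnits_cosets V

lemma hasLifting_cosetSequence (V : Rep.{u} k G) : HasLifting (cosetSequence V).X₂ :=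
  hasLifting_tensor_of_finite V finite_stabilizer_cosets

/-- `M'` is a direct summand of the sum of `M` and a module with the lifting property. -/
def IsStableRetract (M' M : Rep.{u} k G) : Prop :=
  ∃ (Q : Rep.{u} k G) (i : M' ⟶ M) (r : M ⟶ M') (a : M' ⟶ Q) (b : Q ⟶ M'),
    HasLifting Q ∧ i ≫ r + a ≫ b = 𝟙 M'

lemma isStableRetract_of_retract {M' M : Rep.{u} k G} (h : Retract M' M) : IsStableRetract M' M :=
  ⟨_, h.i, h.r, 0, 0, hasLifting_cosetSequence M, by simp⟩

lemma HasLifting.of_isStableRetract {M' M : Rep.{u} k G} (hM : HasLifting M)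
    (h : IsStableRetract M' M) : HasLifting M' := fun B C g hg φ => by
  obtain ⟨Q, i, r, a, b, hQ, e⟩ := h
  obtain ⟨ψ₁, h₁⟩ := hM g hg (r ≫ φ)
  obtain ⟨ψ₂, h₂⟩ := hQ g hg (b ≫ φ)
  refine ⟨i ≫ ψ₁ + a ≫ ψ₂, ?_⟩
  rw [Preadditive.add_comp, Category.assoc, Category.assoc, h₁, h₂, ← Category.assoc,
    ← Category.assoc, ← Preadditive.add_comp, e, Category.id_comp]

/-- A relative form of Schanuel's lemma. -/
theorem isStableRetract_kernel {S S' : ShortComplex (Rep.{u} k G)} (hS : IsLocallySplit S)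
    (hS' : IsLocallySplit S') (hP : HasLifting S.X₂) (hP' : HasLifting S'.X₂)
    (h : IsStableRetract S'.X₃ S.X₃) : IsStableRetract S'.X₁ S.X₁ := by
  obtain ⟨Q, i, r, a, b, hQ, e⟩ := h
  obtain ⟨β, hβ⟩ := hP' S.g hS.epi (S'.g ≫ i)
  obtain ⟨α, hα⟩ := hP S'.g hS'.epi (S.g ≫ r)
  obtain ⟨γ, hγ⟩ := hQ S'.g hS'.epi b
  have := hS.shortExact.mono_f
  have := hS'.shortExact.mono_f
  -- The lifts compose to the identity of `S'.X₂` up to a map into the kernel of `S'.g`.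
  -- Precomposition with `S'.f` kills the term through `γ`, so `S'.X₂` can serve as the
  -- complementary module.
  have hθ : (𝟙 _ - β ≫ α - S'.g ≫ a ≫ γ) ≫ S'.g = 0 := by
    have h1 : (β ≫ α) ≫ S'.g + (S'.g ≫ a ≫ γ) ≫ S'.g = S'.g := by
      simp only [Category.assoc, hα, hγ]
      rw [← Category.assoc β, hβ, Category.assoc, ← Preadditive.comp_add, e, Category.comp_id]
    rw [sub_sub, Preadditive.sub_comp, Preadditive.add_comp, h1, Category.id_comp, sub_self]
  have hβ' : (S'.f ≫ β) ≫ S.g = 0 := by simp [hβ]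
  have hα' : (S.f ≫ α) ≫ S'.g = 0 := by simp [hα]
  let E := hS.shortExact.exact
  let E' := hS'.shortExact.exact
  refine ⟨S'.X₂, E.lift _ hβ', E'.lift _ hα', S'.f, E'.lift _ hθ, hP', ?_⟩
  rw [← cancel_mono S'.f, Preadditive.add_comp, Category.assoc, Category.assoc,
    ShortComplex.Exact.lift_f, ShortComplex.Exact.lift_f, ← Category.assoc,
    ShortComplex.Exact.lift_f]
  simp

/-- Schanuel's lemma compares the given resolution with the coset sequence of `M'`, whose kernel is
again a stable retract. -/
theorem HasFResolution.of_isStableRetract {n : ℕ} {M M' : Rep.{u} k G} (hM : HasFResolution n M)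
    (h : IsStableRetract M' M) : HasFResolution n M' := by
  induction n generalizing M M' with
  | zero => exact hasFResolution_zero (hM.hasLifting.of_isStableRetract h)
  | succ n ih =>
    obtain ⟨S, rfl, hS, hP, hK⟩ := hM.exists_of_succ
    exact (isLocallySplit_cosetSequence M').hasFResolution (hasLifting_cosetSequence M')
      (ih hK (isStableRetract_kernel hS (isLocallySplit_cosetSequence M') hP
        (hasLifting_cosetSequence M') h))

lemma HasFResolution.of_retract {n : ℕ} {M M' : Rep.{u} k G} (hM : HasFResolution n M)
    (h : Retract M' M) : HasFResolution n M' :=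
  hM.of_isStableRetract (isStableRetract_of_retract h)

/-- Kernels in partial resolutions by modules with the lifting property have shorter
resolutions. -/
theorem HasFResolution.kernel {n : ℕ} {S : ShortComplex (Rep.{u} k G)}
    (h : HasFResolution (n + 1) S.X₃) (hS : IsLocallySplit S) (hP : HasLifting S.X₂) :
    HasFResolution n S.X₁ := by
  obtain ⟨T, e, hT, hP', hK⟩ := h.exists_of_succ
  refine hK.of_isStableRetract (isStableRetract_kernel hT hS hP' hP ?_)
  rw [e]
  exact isStableRetract_of_retract (Retract.refl _)

lemma HasLifting.hasFResolution_one {M : Rep.{u} k G} (hM : HasLifting M) :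
    HasFResolution 1 M := by
  let Z : Rep.{u} k G := Rep.trivial k G PUnit.{u + 1}
  let S : ShortComplex (Rep.{u} k G) := ShortComplex.mk (0 : Z ⟶ M) (𝟙 M) (by simp)
  have hS : IsLocallySplit S := fun K _ =>
    ⟨(0 : M →ₗ[k] PUnit.{u + 1}), (LinearMap.id : M →ₗ[k] M), fun _ _ _ => rfl, fun _ _ _ => rfl,
      fun _ => rfl, fun _ => rfl, fun x => zero_add x⟩
  refine hS.hasFResolution hM (hasFResolution_zero fun B C g hg φ => ⟨0, ?_⟩)
  refine hom_ext_apply fun x => ?_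
  have hx : x = 0 := Subsingleton.elim (α := PUnit.{u + 1}) _ _
  rw [hx, map_zero, map_zero]

lemma HasFResolution.succ_of {n : ℕ} {M : Rep.{u} k G} (hM : HasFResolution n M) :
    HasFResolution (n + 1) M := by
  induction n generalizing M with
  | zero => exact hM.hasLifting.hasFResolution_one
  | succ n ih =>
    obtain ⟨S, rfl, hS, hP, hK⟩ := hM.exists_of_succ
    exact hS.hasFResolution hP (ih hK)

lemma HasFResolution.mono {n m : ℕ} (hnm : n ≤ m) {M : Rep.{u} k G} (hM : HasFResolution n M) :
    HasFResolution m M := by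
  induction hnm with
  | refl => exact hM
  | step _ ih => exact ih.succ_of

/-- If the first two terms of an `𝔉`-split sequence have resolutions of length `n`, then the third
has one of length `n + 1`. -/
theorem IsLocallySplit.hasFResolution_third {n : ℕ} {S : ShortComplex (Rep.{u} k G)}
    (hS : IsLocallySplit S) (h₁ : HasFResolution n S.X₁) (h₂ : HasFResolution n S.X₂) :
    HasFResolution (n + 1) S.X₃ := by
  induction n generalizing S with
  | zero => exact hS.hasFResolution h₂.hasLifting h₁
  | succ n ih =>
    -- The coset sequence is functorial: its kernels are obtained by tensoring `S` with `augKernel`,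
    -- so they form a locally split sequence of dimension one lower.
    have h {V : Rep.{u} k G} (hV : HasFResolution (n + 1) V) :
        HasFResolution n (cosetSequence V).X₁ :=
      HasFResolution.kernel (S := cosetSequence V) hV (isLocallySplit_cosetSequence V)
        (hasLifting_cosetSequence V)
    exact (isLocallySplit_cosetSequence S.X₃).hasFResolution (hasLifting_cosetSequence _)
      (ih (hS.map_tensorRight (augKernel k G (Cosets G))) (h h₁) (h h₂))

/-! ### Tensor products and the trivial module -/

section Tensor

/-- `P` is a summand of `P ⊗ kΔ`, and `(P ⊗ kΔ) ⊗ N ≅ (P ⊗ N) ⊗ kΔ`. -/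
lemma HasLifting.tensorRight {P : Rep.{u} k G} (hP : HasLifting P) (N : Rep.{u} k G) :
    HasLifting ((tensorRight N).obj P) := by
  obtain ⟨ρ⟩ := hP.exists_retract hasInvariantUnits_cosets
  let A := (FCoh.tensorRight N).obj ((FCoh.tensorRight (permModule k G)).obj P)
  let B := (FCoh.tensorRight (permModule k G)).obj ((FCoh.tensorRight N).obj P)
  have hB : HasLifting B := hasLifting_tensor_of_finite _ finite_stabilizer_cosets
  let e : (P ⊗[k] k[Cosets G]) ⊗[k] N ≃ₗ[k] (P ⊗[k] N) ⊗[k] k[Cosets G] :=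
    TensorProduct.rightComm k P k[Cosets G] N
  have he : ∀ g, e.toLinearMap ∘ₗ A.ρ g = B.ρ g ∘ₗ e.toLinearMap := fun g =>
    TensorProduct.ext_threefold fun p x n => rfl
  have he' : ∀ g, e.symm.toLinearMap ∘ₗ B.ρ g = A.ρ g ∘ₗ e.symm.toLinearMap := fun g =>
    TensorProduct.ext_threefold fun p n x => rfl
  let i : A ⟶ B := homMk e.toLinearMap fun g x => LinearMap.congr_fun (he g) x
  let r : B ⟶ A := homMk e.symm.toLinearMap fun g x => LinearMap.congr_fun (he' g) x
  have hA : HasLifting A :=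
    hB.of_retract ⟨i, r, comp_eq_iff.2 fun x => e.symm_apply_apply x⟩
  exact hA.of_retract (ρ.map _)

theorem HasFResolution.tensorRight {n : ℕ} {M : Rep.{u} k G} (hM : HasFResolution n M)
    (N : Rep.{u} k G) : HasFResolution n ((tensorRight N).obj M) := by
  induction n generalizing M with
  | zero => exact hasFResolution_zero (hM.hasLifting.tensorRight N)
  | succ n ih =>
    obtain ⟨S, rfl, hS, hP, hK⟩ := hM.exists_of_succ
    exact (hS.map_tensorRight N).hasFResolution (hP.tensorRight N) (ih hK)

/-- The trivial module `k`, lifted to the universe of `G`. -/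
abbrev unitRep (k : Type) [CommRing k] (G : Type u) [Group G] : Rep.{u} k G :=
  Rep.trivial k G (ULift.{u} k)

/-- Tensor a resolution of `k` with `M` and use `k ⊗ M ≅ M`. -/
theorem HasFResolution.of_unit {n : ℕ} (h : HasFResolution n (unitRep k G)) (M : Rep.{u} k G) :
    HasFResolution n M := by
  let l : ULift.{u} k →ₗ[k] (M →ₗ[k] M) :=
    LinearMap.lsmul k M ∘ₗ ULift.moduleEquiv.toLinearMap
  let i : M ⟶ (FCoh.tensorRight M).obj (unitRep k G) :=
    homMk (TensorProduct.mk k (ULift.{u} k) M ⟨1⟩) fun g m => rfl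
  let r : (FCoh.tensorRight M).obj (unitRep k G) ⟶ M :=
    homMk (TensorProduct.lift l) fun g => LinearMap.congr_fun
      (f := TensorProduct.lift l ∘ₗ ((FCoh.tensorRight M).obj (unitRep k G)).ρ g)
      (g := M.ρ g ∘ₗ TensorProduct.lift l) <|
      TensorProduct.ext' (M := ULift.{u} k) (N := M) fun z m => ((M.ρ g).map_smul z.down m).symm
  exact (h.tensorRight M).of_retract ⟨i, r, comp_eq_iff.2 fun m => one_smul k m⟩

end Tensor

/-! ### Restriction and inflation -/

section Restriction

/-- Restriction along a homomorphism commutes with tensoring with a permutation module. -/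
def resTensorRetract (φ : H →* G) (X : Type u) [MulAction G X] [MulAction H X]
    (hX : ∀ (h : H) (x : X), h • x = φ h • x) (V : Rep.{u} k G) :
    Retract (Rep.res φ ((tensorRight (Rep.ofMulAction k G X)).obj V))
      ((tensorRight (Rep.ofMulAction k H X)).obj (Rep.res φ V)) :=
  have key (h : H) : ((tensorRight (Rep.ofMulAction k G X)).obj V).ρ (φ h) =
      ((tensorRight (Rep.ofMulAction k H X)).obj (Rep.res φ V)).ρ h :=
    perm_hom_ext fun x v => by
      refine (permIncl_smul V (φ h) x v).trans ?_
      rw [← hX h x]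
      exact (permIncl_smul (Rep.res φ V) h x v).symm
  { i := homMk (A := Rep.res φ ((tensorRight (Rep.ofMulAction k G X)).obj V))
      (LinearMap.id : V ⊗[k] k[X] →ₗ[k] V ⊗[k] k[X]) fun h => LinearMap.congr_fun (key h)
    r := homMk (B := Rep.res φ ((tensorRight (Rep.ofMulAction k G X)).obj V))
      (LinearMap.id : V ⊗[k] k[X] →ₗ[k] V ⊗[k] k[X]) fun h => LinearMap.congr_fun (key h).symm
    retract := comp_eq_iff.2 fun _ => rfl }

lemma finite_stabilizer_comp {φ : H →* G} (hφ : Function.Injective φ) {X : Type u} [MulAction G X]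
    [MulAction H X] (hX : ∀ (h : H) (x : X), h • x = φ h • x) (x : X)
    [Finite (MulAction.stabilizer G x)] : Finite (MulAction.stabilizer H x) :=
  Finite.of_injective (β := MulAction.stabilizer G x)
    (fun h => ⟨φ h.1, by rw [MulAction.mem_stabilizer_iff, ← hX]; exact h.2⟩)
    fun a b hab => Subtype.ext (hφ (congrArg Subtype.val hab))

/-- `Δ` for `G`, viewed as an `H`-set, still has finite stabilisers; this is where injectivity
enters. -/
lemma HasLifting.res {P : Rep.{u} k G} (hP : HasLifting P) {φ : H →* G}
    (hφ : Function.Injective φ) : HasLifting (Rep.res φ P) := by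
  obtain ⟨ρ⟩ := hP.exists_retract hasInvariantUnits_cosets
  let _ : MulAction H (Cosets G) := MulAction.compHom _ φ
  have hX : ∀ (h : H) (x : Cosets G), h • x = φ h • x := fun _ _ => rfl
  refine HasLifting.of_retract (hasLifting_tensor_of_finite (X := Cosets G) (Rep.res φ P)
    fun x => ?_) ((ρ.map (Rep.resFunctor φ)).trans (resTensorRetract φ (Cosets G) hX P))
  have := finite_stabilizer_cosets x
  exact finite_stabilizer_comp hφ hX x

theorem HasFResolution.res {n : ℕ} {M : Rep.{u} k G} (hM : HasFResolution n M) {φ : H →* G}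
    (hφ : Function.Injective φ) : HasFResolution n (Rep.res φ M) := by
  induction n generalizing M with
  | zero => exact hasFResolution_zero (hM.hasLifting.res hφ)
  | succ n ih =>
    obtain ⟨S, rfl, hS, hP, hK⟩ := hM.exists_of_succ
    exact (hS.map_res φ).hasFResolution (hP.res hφ) (ih hK)

/-- If `V` has resolutions of length `n` over the stabilisers of a `G`-set `X`, then `V ⊗ kX` has
one over `G`. -/
theorem hasFResolution_tensor_ofMulAction {X : Type u} [MulAction G X] {n : ℕ} (V : Rep.{u} k G)
    (hV : ∀ x : X, HasFResolution n (Rep.res (MulAction.stabilizer G x).subtype V)) :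
    HasFResolution n ((tensorRight (Rep.ofMulAction k G X)).obj V) := by
  induction n generalizing V with
  | zero => exact hasFResolution_zero (hasLifting_tensor_ofMulAction V fun x => (hV x).hasLifting)
  | succ n ih =>
    have hS := isLocallySplit_cosetSequence V
    have hP := hasLifting_cosetSequence V
    have hP' (x : X) := hP.res (MulAction.stabilizer G x).subtype_injective
    -- The coset sequence restricts to a locally split sequence with liftable middle term over each
    -- stabiliser, so its kernel satisfies the hypothesis for `n`.
    exact (hS.map_tensorRight (Rep.ofMulAction k G X)).hasFResolution
      (hasLifting_tensor_ofMulAction _ hP')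
      (ih _ fun x => HasFResolution.kernel
        (S := (cosetSequence V).map (Rep.resFunctor (MulAction.stabilizer G x).subtype))
        (hV x) (hS.map_res _) (hP' x))

/-- Resolutions over `Q` give resolutions over a group mapping to `Q`, if the preimages of the
stabilisers of a suitable `Q`-set have bounded dimension. -/
theorem HasFResolution.inflate {Q : Type u} [Group Q] (π : G →* Q) {X : Type u} [MulAction Q X]
    (hX : HasInvariantUnits k Q X) {n m : ℕ}
    (hn : ∀ x : X, HasFResolution n (unitRep k ((MulAction.stabilizer Q x).comap π)))
    {M : Rep.{u} k Q} (hM : HasFResolution m M) : HasFResolution (n + m) (Rep.res π M) := by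
  have lift {P : Rep.{u} k Q} (hP : HasLifting P) : HasFResolution n (Rep.res π P) := by
    obtain ⟨ρ⟩ := hP.exists_retract hX
    let _ : MulAction G X := MulAction.compHom _ π
    refine HasFResolution.of_retract (hasFResolution_tensor_ofMulAction (X := X) (Rep.res π P)
      fun x => ?_) ((ρ.map (Rep.resFunctor π)).trans (resTensorRetract π X (fun _ _ => rfl) P))
    exact HasFResolution.of_unit (hn x) _
  induction m generalizing M with
  | zero => exact lift hM.hasLifting
  | succ m ih =>
    obtain ⟨S, rfl, hS, hP, hK⟩ := hM.exists_of_succ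
    -- The inflated middle term has dimension at most `n`, the kernel at most `n + m`.
    exact (hS.map_res π).hasFResolution_third (ih hK) ((lift hP).mono (Nat.le_add_right n m))

end Restriction

/-! ### Reduction to subgroups of prime power order -/

section PrimePower

/-- A finite subgroup of prime power order. -/
def IsFinitePrimePower (F : Subgroup G) : Prop :=
  Finite F ∧ ∃ p : ℕ, p.Prime ∧ IsPGroup p F

/-- The `G`-set of all cosets of finite subgroups of prime power order. -/
abbrev PrimePowerCosets (G : Type u) [Group G] : Type u :=
  Σ K : {K : Subgroup G // IsFinitePrimePower K}, G ⧸ K.1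

lemma isFinitePrimePower_map {K : Subgroup H} (hK : IsFinitePrimePower K) (φ : H →* G) :
    IsFinitePrimePower (K.map φ) := by
  obtain ⟨hf, p, hp, hK⟩ := hK
  exact ⟨finite_map_subgroup φ K, p, hp, hK.map φ⟩

/-- The sum over a finite orbit is an invariant element of the permutation module. -/
lemma exists_invariant_of_orbit {X : Type u} [MulAction G X] (K : Subgroup G) [Finite K] (x : X) :
    ∃ e : k[X], (∀ h ∈ K, Representation.ofMulAction k G X h e = e) ∧
      aug k X e = ((MulAction.stabilizer K x).index : k) := by
  classical
  have : Finite (MulAction.orbit K x) := (Set.finite_range fun h : K => h • x).to_subtype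
  have := Fintype.ofFinite (MulAction.orbit K x)
  refine ⟨∑ y : MulAction.orbit K x, MonoidAlgebra.single (y : X) 1, fun h hh => ?_, ?_⟩
  · rw [map_sum]
    simp only [Representation.ofMulAction_single]
    exact Fintype.sum_equiv (MulAction.toPerm (⟨h, hh⟩ : K)) _ _ fun y => rfl
  · rw [map_sum, MulAction.index_stabilizer, Set.ncard_eq_toFinset_card']
    simp

/-- Subgroups of prime power order suffice to detect splittings over finite subgroups. -/
theorem hasInvariantUnits_primePowerCosets : HasInvariantUnits k G (PrimePowerCosets G) :=
  fun K hK => by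
  -- The integers that are augmentations of `K`-invariant elements form an ideal.
  let J : Ideal ℤ :=
    { carrier := {d | ∃ e : k[PrimePowerCosets G],
        (∀ h ∈ K, Representation.ofMulAction k G _ h e = e) ∧ aug k _ e = (d : k)}
      add_mem' := by
        rintro a b ⟨e, he, he'⟩ ⟨f, hf, hf'⟩
        exact ⟨e + f, fun h hh => by rw [map_add, he h hh, hf h hh],
          by rw [map_add, he', hf', Int.cast_add]⟩
      zero_mem' := ⟨0, fun h hh => map_zero _, by simp⟩
      smul_mem' := by
        rintro c a ⟨e, he, he'⟩
        exact ⟨(c : k) • e, fun h hh => by rw [map_smul, he h hh], by simp [he']⟩ }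
  suffices h : (1 : ℤ) ∈ J by
    obtain ⟨e, he, he'⟩ := h
    exact ⟨e, he, by rw [he', Int.cast_one]⟩
  by_contra h1
  obtain ⟨d, hd⟩ : ∃ d : ℤ, J = Ideal.span {d} := IsPrincipalIdealRing.principal J |>.principal
  have hd1 : d.natAbs ≠ 1 := fun h => h1 <| by
    rw [hd, Ideal.mem_span_singleton]
    exact Int.isUnit_iff_natAbs_eq.2 h |>.dvd
  -- A generator `d = 0` is covered as well. The `K`-orbit of the coset of a Sylow `q`-subgroup has
  -- length prime to `q`, yet that length lies in `J`.
  obtain ⟨q, hq, hqd⟩ := Nat.exists_prime_and_dvd hd1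
  have := Fact.mk hq
  let P : Sylow q K := default
  have hF : IsFinitePrimePower ((P : Subgroup K).map K.subtype) :=
    isFinitePrimePower_map ⟨inferInstance, q, hq, P.isPGroup'⟩ _
  let x : PrimePowerCosets G := ⟨⟨_, hF⟩, ((1 : G) : G ⧸ (P : Subgroup K).map K.subtype)⟩
  obtain ⟨e, he, he'⟩ := exists_invariant_of_orbit (k := k) K x
  have hmem : ((MulAction.stabilizer K x).index : ℤ) ∈ J := ⟨e, he, by rw [he']; norm_cast⟩
  rw [hd, Ideal.mem_span_singleton] at hmem
  have hle : (P : Subgroup K) ≤ MulAction.stabilizer K x := fun y hy =>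
    smul_coset_one IsFinitePrimePower hF (Subgroup.mem_map_of_mem K.subtype hy)
  refine P.not_dvd_index (hqd.trans (Dvd.dvd.trans ?_ (Subgroup.index_dvd_of_le hle)))
  exact Int.natAbs_dvd_natAbs.2 hmem

end PrimePower

/-! ### Dimensions of groups and extensions -/

section Dimension

lemma fpd_le_iff {M : Rep.{u} k G} {n : ℕ} : fpd M ≤ n ↔ HasFResolution n M := by
  refine ⟨fun h => ?_, fun h => iInf₂_le n h⟩
  have h' : fpd M < ((n + 1 : ℕ) : ℕ∞) := h.trans_lt (by exact_mod_cast Nat.lt_succ_self n)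
  simp only [fpd, iInf_lt_iff] at h'
  obtain ⟨m, hm, hlt⟩ := h'
  exact hm.mono (Nat.lt_succ_iff.1 (by exact_mod_cast hlt))

lemma fcd_le_iff {n : ℕ} : fcd G ≤ n ↔ HasFResolution n (unitRep ℤ G) :=
  fpd_le_iff

lemma fcd_le_of_injective {φ : H →* G} (hφ : Function.Injective φ) {n : ℕ} (h : fcd G ≤ n) :
    fcd H ≤ n :=
  fcd_le_iff.2 ((fcd_le_iff.1 h).res hφ)

lemma fcd_of_finite [Finite G] : fcd G = 0 :=
  nonpos_iff_eq_zero.1 (fcd_le_iff (n := 0).2 (hasFResolution_zero (hasLifting_of_finite _)))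

/-- The extension of `F'.comap π` by `F ⧸ F'`, for a normal subgroup `F'` of `F ≤ Q`. -/
def comapExtension {Q : Type u} [Group Q] {π : G →* Q} (hπ : Function.Surjective π)
    (F : Subgroup Q) (F' : Subgroup F) [F'.Normal] :
    GroupExtension ((F'.map F.subtype).comap π) (F.comap π) (F ⧸ F') where
  inl := Subgroup.inclusion (Subgroup.comap_mono (Subgroup.map_subtype_le F'))
  rightHom := (QuotientGroup.mk' F').comp (π.subgroupComap F)
  inl_injective := Subgroup.inclusion_injective _
  range_inl_eq_ker_rightHom := by
    rw [Subgroup.inclusion_range]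
    ext x
    rw [Subgroup.mem_subgroupOf, Subgroup.mem_comap, MonoidHom.mem_ker, MonoidHom.comp_apply,
      QuotientGroup.mk'_apply, QuotientGroup.eq_one_iff]
    exact Subgroup.mem_map_iff_mem (f := F.subtype) F.subtype_injective (x := π.subgroupComap F x)
  rightHom_surjective := (QuotientGroup.mk'_surjective F').comp
    (π.subgroupComap_surjective_of_surjective F hπ)

/-- The preimages of finite subgroups of prime power order have bounded dimension. -/
theorem fcd_comap_le {N Q : Type u} [Group N] [Group Q] (E : GroupExtension N G Q) {n : ℕ}
    (hN : fcd N ≤ n) (hG : PrimeExtensionsBounded G n) (F : Subgroup Q) [Finite F] {p : ℕ}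
    [Fact p.Prime] (hF : IsPGroup p F) : fcd (F.comap E.rightHom) ≤ n := by
  obtain ⟨a, ha⟩ := IsPGroup.iff_card.1 hF
  induction a generalizing F with
  | zero =>
    have hle : F.comap E.rightHom ≤ E.inl.range := by
      rw [pow_zero, Subgroup.card_eq_one] at ha
      rw [ha, E.range_inl_eq_ker_rightHom]
      exact le_rfl
    let e : N ≃* E.inl.range := MonoidHom.ofInjective E.inl_injective
    refine fcd_le_of_injective (φ := e.symm.toMonoidHom.comp (Subgroup.inclusion hle)) ?_ hN
    exact e.symm.injective.comp (Subgroup.inclusion_injective hle)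
  | succ a ih =>
    obtain ⟨F', hF'⟩ := Sylow.exists_subgroup_card_pow_prime (G := F) p (n := a)
      (by rw [ha]; exact pow_dvd_pow p a.le_succ)
    have hp : p.Prime := Fact.out
    have hindex : F'.index = p := by
      have h := F'.card_mul_index
      rw [ha, hF', pow_succ] at h
      exact Nat.eq_of_mul_eq_mul_left (pow_pos hp.pos a) h
    -- A subgroup whose index is the smallest prime factor of the group order is normal.
    have : F'.Normal := Subgroup.normal_of_index_eq_minFac_card (by
      rw [hindex, ha, hp.pow_minFac a.succ_ne_zero])
    have := finite_map_subgroup F.subtype F'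
    -- The preimage of `F` extends the preimage of `F'` by the group `F ⧸ F'` of order `p`.
    refine hG _ (ih (F'.map F.subtype) ((hF.to_subgroup F').map F.subtype) ?_) _ (F ⧸ F') ?_
      (comapExtension E.rightHom_surjective F F')
    · rw [← hF']
      exact (Nat.card_congr (F'.equivMapOfInjective _ F.subtype_injective).toEquiv).symm
    · rwa [← Subgroup.index_eq_card, hindex]

theorem fcd_le_add {N Q : Type u} [Group N] [Group Q] (E : GroupExtension N G Q) {n : ℕ}
    (hN : fcd N ≤ n) (hG : PrimeExtensionsBounded G n) : fcd G ≤ n + fcd Q := by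
  induction hm : fcd Q using ENat.recTopCoe with
  | top => simp
  | coe m =>
    have hQ := fcd_le_iff.1 hm.le
    rw [← Nat.cast_add, fcd_le_iff]
    refine hQ.inflate E.rightHom hasInvariantUnits_primePowerCosets fun x => fcd_le_iff.1 ?_
    obtain ⟨K, g, hK, h⟩ := stabilizer_sigma_coset IsFinitePrimePower x
    obtain ⟨hf, p, hp, hpK⟩ := isFinitePrimePower_map hK (MulAut.conj g).toMonoidHom
    rw [h]
    have := Fact.mk hp
    exact fcd_comap_le E hN hG _ hpK

end Dimension

end
end FCoh

theorem mainTheorem4 :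
    -- the bound for one extension `N ↪ G ↠ Q` and any `n ≥ fcd N`
    (∀ (N G Q : Type u) [Group N] [Group G] [Group Q], GroupExtension N G Q →
      ∀ n : ℕ, FCoh.fcd N ≤ n → FCoh.PrimeExtensionsBounded G n →
        FCoh.fcd G ≤ n + FCoh.fcd Q) ∧
    -- the case `n = fcd N`
    (∀ (N G Q : Type u) [Group N] [Group G] [Group Q], GroupExtension N G Q →
      FCoh.PrimeExtensionsBounded G (FCoh.fcd N) →
        FCoh.fcd G ≤ FCoh.fcd N + FCoh.fcd Q) ∧
    -- subadditivity for all extensions reduces to extensions by groups of prime order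
    ((∀ (N G Q : Type u) [Group N] [Group G] [Group Q], GroupExtension N G Q →
        FCoh.fcd G ≤ FCoh.fcd N + FCoh.fcd Q) ↔
      (∀ (H L C : Type u) [Group H] [Group L] [Group C], (Nat.card C).Prime →
        GroupExtension H L C → FCoh.fcd L ≤ FCoh.fcd H)) := by
  have part2 : ∀ (N G Q : Type u) [Group N] [Group G] [Group Q], GroupExtension N G Q →
      FCoh.PrimeExtensionsBounded G (FCoh.fcd N) →
        FCoh.fcd G ≤ FCoh.fcd N + FCoh.fcd Q := fun N G Q _ _ _ E h => by
    induction hn : FCoh.fcd N using ENat.recTopCoe with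
    | top => simp
    | coe n => exact FCoh.fcd_le_add E hn.le (hn ▸ h)
  refine ⟨fun N G Q _ _ _ E n hN hG => FCoh.fcd_le_add E hN hG, part2,
    fun h H L C _ _ _ hC E => ?_, fun h N G Q _ _ _ E => part2 N G Q E ?_⟩
  -- A finite `C` contributes dimension zero.
  · have : Finite C := Nat.finite_of_card_ne_zero hC.ne_zero
    simpa [FCoh.fcd_of_finite (G := C)] using h H L C E
  · intro H hH L C _ _ hC E'
    exact (h H L C hC E').trans hH
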